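/- Let $1\le d<m$, let $M\subseteq\mathbb R^m$ and let $p\in M$ be a point near which $M$ is an embedded $C^2$ submanifold of dimension $d$, with the Riemannian metric induced from $\mathbb R^m$. Let $P$ be a probability distribution on $\mathbb R^m$ which, on a neighbourhood of $p$, is concentrated on $M$ and has there, with respect to the Riemannian volume measure of $M$, a Lipschitz continuous density $g$ with $g(p)\neq 0$. Let $X_1,X_2,\dots$ be i.i.d. random vectors with distribution $P$. Fix a constant $C>0$ and put $k=k(n)=\lceil C\log n\rceil$. For each $n$ let $N_n\subseteq\{1,\dots,n\}$ be the (random) set of indices of $k$ nearest neighbours of $p$ among $X_1,\dots,X_n$ in the Euclidean distance of $\mathbb R^m$, ties being broken by any measurable rule (and $N_n=\{1,\dots,n\}$ for the finitely many $n$ with $n<k$). Let $\pi:\mathbb R^m\to T_pM$ be the orthogonal projection onto the embedded tangent space of $M$ at $p$. Write $\widehat y=y/\|y\|$ for $y\ne0$ and $\widehat 0=0$, put $Y_i=X_i-p$, $W_i=\pi(X_i-p)$, and define $$U_{k,n}=\frac1{\binom k2}\sum_{\substack{i<j\\ i,j\in N_n}}\Bigl(\arccos\langle\widehat{Y_i},\widehat{Y_j}\rangle-\frac\pi2\Bigr)^2,\qquad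 V_{k,n}=\frac1{\binom k2}\sum_{\substack{i<j\\ i,j\in N_n}}\Bigl(\arccos\langle\widehat{W_i},\widehat{W_j}\rangle-\frac\pi2\Bigr)^2$$ (both are $0$ for the finitely many $n$ with $k<2$). Then: 1. $k\,(U_{k,n}-V_{k,n})\to0$ in probability as $n\to\infty$; 2. $U_{k,n}-V_{k,n}$ is integrable for every $n$, and $\lim_{n\to\infty}\mathbb E\,(U_{k,n}-V_{k,n})=0$. -/

import Mathlib

open MeasureTheory ProbabilityTheory Filter Topology
open scoped ENNReal NNReal

noncomputable section

namespace AngleVariance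

/-- `φ`, restricted to `V`, is a regular `C²` parametrization, with `d` parameters, of a relatively
open subset of `M ⊆ ℝᵐ`: an immersion of class `C²` on the open set `V` which is a homeomorphism
onto its image, the image being relatively open in `M`. -/
structure IsC2Param {m : ℕ} (d : ℕ) (M : Set (EuclideanSpace ℝ (Fin m)))
    (φ : EuclideanSpace ℝ (Fin d) → EuclideanSpace ℝ (Fin m))
    (V : Set (EuclideanSpace ℝ (Fin d))) : Prop where
  isOpen_domain : IsOpen V
  contDiffOn : ContDiffOn ℝ 2 φ V
  injective_fderiv : ∀ v ∈ V, Function.Injective (fderiv ℝ φ v)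
  isEmbedding : IsEmbedding (V.domRestrict φ)
  image_open : ∃ U : Set (EuclideanSpace ℝ (Fin m)), IsOpen U ∧ φ '' V = M ∩ U

/-- `p` is a point of `M` near which `M` is an embedded `C²` submanifold of dimension `d`. -/
def IsC2SubmanifoldAt {m : ℕ} (d : ℕ) (M : Set (EuclideanSpace ℝ (Fin m)))
    (p : EuclideanSpace ℝ (Fin m)) : Prop :=
  ∃ φ V, IsC2Param d M φ V ∧ p ∈ φ '' V

/-- The density `√det (⟨∂ᵢ, ∂ⱼ⟩)ᵢⱼ` of the Riemannian volume in the coordinates given by `φ`, where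
`∂ᵢ` is the `i`-th partial derivative of `φ` and the metric is the one induced from `ℝᵐ`. -/
def volumeDensity {m d : ℕ} (φ : EuclideanSpace ℝ (Fin d) → EuclideanSpace ℝ (Fin m))
    (v : EuclideanSpace ℝ (Fin d)) : ℝ :=
  Real.sqrt (Matrix.det (Matrix.of fun i j : Fin d =>
    inner ℝ (fderiv ℝ φ v (EuclideanSpace.single i 1))
      (fderiv ℝ φ v (EuclideanSpace.single j 1))))

/-- The Riemannian volume measure of the parametrized piece `φ '' V`, as a measure on `ℝᵐ`:
the image under `φ` of `√det (⟨∂ᵢ, ∂ⱼ⟩) dx₁ … dx_d` on `V`. -/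
def paramVolume {m d : ℕ} (φ : EuclideanSpace ℝ (Fin d) → EuclideanSpace ℝ (Fin m))
    (V : Set (EuclideanSpace ℝ (Fin d))) : Measure (EuclideanSpace ℝ (Fin m)) :=
  ((volume.restrict V).withDensity fun v => ENNReal.ofReal (volumeDensity φ v)).map φ

/-- The Riemannian volume measure of (the `d`-dimensional `C²` part of) `M`, as a measure on `ℝᵐ`:
the least measure that dominates the volume measures of all parametrized pieces of `M`. The volume
measures of two pieces agree on their overlap, so on each piece this is the volume of that piece. -/
def volumeMeasure {m : ℕ} (d : ℕ) (M : Set (EuclideanSpace ℝ (Fin m))) :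
    Measure (EuclideanSpace ℝ (Fin m)) :=
  sSup {ν | ∃ φ V, IsC2Param d M φ V ∧ ν = paramVolume φ V}

/-- The embedded tangent space `T_pM ⊆ ℝᵐ`, the span of the limits of rescaled secants of `M`
at `p`. -/
def tangentSpaceAt {m : ℕ} (M : Set (EuclideanSpace ℝ (Fin m)))
    (p : EuclideanSpace ℝ (Fin m)) : Submodule ℝ (EuclideanSpace ℝ (Fin m)) :=
  Submodule.span ℝ (tangentConeAt ℝ M p)

/-- Near `p` the distribution `P` lives on `M` and has there, with respect to the volume measure
of `M`, a Lipschitz continuous density that does not vanish at `p`. -/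
def HasLipschitzDensityNear {m : ℕ} (d : ℕ) (M : Set (EuclideanSpace ℝ (Fin m)))
    (P : Measure (EuclideanSpace ℝ (Fin m))) (p : EuclideanSpace ℝ (Fin m)) : Prop :=
  ∃ (U : Set (EuclideanSpace ℝ (Fin m))) (g : EuclideanSpace ℝ (Fin m) → ℝ≥0) (L : ℝ≥0),
    IsOpen U ∧ p ∈ U ∧ LipschitzOnWith L g (M ∩ U) ∧ g p ≠ 0 ∧
      P.restrict U = ((volumeMeasure d M).withDensity fun x => (g x : ℝ≥0∞)).restrict U

/-- `S` is a set of (indices of) `k` nearest neighbours of `p` among `x 0, …, x (n - 1)`; ties may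
be broken in any way, and the whole sample is taken if it has fewer than `k` points. -/
def IsNearestNeighbors {m : ℕ} (p : EuclideanSpace ℝ (Fin m))
    (x : ℕ → EuclideanSpace ℝ (Fin m)) (n k : ℕ) (S : Finset ℕ) : Prop :=
  S ⊆ Finset.range n ∧ S.card = min k n ∧
    ∀ i ∈ S, ∀ j ∈ Finset.range n, j ∉ S → dist (x i) p ≤ dist (x j) p

/-- The unit vector `y / ‖y‖` (and `0` for `y = 0`). -/
def unitVector {m : ℕ} (y : EuclideanSpace ℝ (Fin m)) : EuclideanSpace ℝ (Fin m) :=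
  ‖y‖⁻¹ • y

/-- The average over the pairs `i < j` in the `k`-element set `S` of
`(arccos ⟨y i / ‖y i‖, y j / ‖y j‖⟩ - π / 2) ^ 2`. -/
def angleStatistic {m : ℕ} (k : ℕ) (S : Finset ℕ) (y : ℕ → EuclideanSpace ℝ (Fin m)) : ℝ :=
  1 / (k.choose 2 : ℝ) * ∑ i ∈ S, ∑ j ∈ S with i < j,
    (Real.arccos (inner ℝ (unitVector (y i)) (unitVector (y j))) - Real.pi / 2) ^ 2

/-- The number `k = ⌈C log n⌉` of neighbours. -/
def numNeighbors (C : ℝ) (n : ℕ) : ℕ := ⌈C * Real.log n⌉₊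

/-- The angle-variance statistic `U_{k,n}` at `p` of the points `x i`, `i ∈ S`. -/
def statU {m : ℕ} (p : EuclideanSpace ℝ (Fin m)) (k : ℕ) (S : Finset ℕ)
    (x : ℕ → EuclideanSpace ℝ (Fin m)) : ℝ :=
  angleStatistic k S fun i => x i - p

/-- Its tangent analogue `V_{k,n}`, computed on the orthogonal projections onto `T_pM`. -/
def statV {m : ℕ} (M : Set (EuclideanSpace ℝ (Fin m))) (p : EuclideanSpace ℝ (Fin m)) (k : ℕ)
    (S : Finset ℕ) (x : ℕ → EuclideanSpace ℝ (Fin m)) : ℝ :=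
  angleStatistic k S fun i => (tangentSpaceAt M p).starProjection (x i - p)

end AngleVariance

end

/-! ### Angles, projections and averages over pairs -/

namespace AngleVariance

open InnerProductGeometry

/-! Near `p` almost every sample point lies on a `C²` piece of `M`, whose points `x` deviate from
the tangent space by at most `K‖x - p‖²`. A point within distance `r` of `p` is therefore turned by
an angle of at most `(π/2)Kr` under the projection (`angle_starProjection_le`). If all `k`
neighbours lie within `r`, the two statistics differ by at most `4π²Kr`
(`abs_angleStatistic_sub_le`).

The choice `r = η/k` makes `k|U - V| ≤ 4π²Kη`, which is below `ε` for small `η`. It remains to see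
that this shrinking ball usually contains `k` sample points. Its mass is at least `c(η/k)^d`
(`exists_le_measure_closedBall`), so the expected count is at least `k` times a multiple of
`n/k^(d+1)`. That ratio tends to infinity because `k` is logarithmic, and Chebyshev's inequality
concludes (`measure_card_filter_lt_le`).

The expectations converge by bounded convergence, since `|U - V|` is bounded and `k ≥ 1` eventually.
-/

lemma abs_sq_sub_sq_le {a b B : ℝ} (ha : |a| ≤ B) (hb : |b| ≤ B) :
    |a ^ 2 - b ^ 2| ≤ 2 * B * |a - b| := by
  rw [sq_sub_sq, abs_mul]
  have : |a + b| ≤ 2 * B := (abs_add_le a b).trans (by linarith)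
  gcongr

/-- Two uses of the triangle inequality for angles in each direction, changing one argument at a
time. -/
lemma abs_angle_sub_angle_le {E : Type*} [NormedAddCommGroup E] [InnerProductSpace ℝ E]
    (x y x' y' : E) : |angle x y - angle x' y'| ≤ angle x x' + angle y y' := by
  have h1 := angle_le_angle_add_angle x x' y
  have h2 := angle_le_angle_add_angle x' y' y
  have h3 := angle_le_angle_add_angle x' x y'
  have h4 := angle_le_angle_add_angle x y y'
  rw [angle_comm y' y] at h2
  rw [angle_comm x' x] at h3
  rw [abs_le]
  constructor <;> linarith

/-- If `y` is close to the subspace `T`, then the angle between `y` and its orthogonal projection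
onto `T` is small. -/
lemma angle_starProjection_le {E : Type*} [NormedAddCommGroup E] [InnerProductSpace ℝ E]
    (T : Submodule ℝ E) [T.HasOrthogonalProjection] {y : E} {δ : ℝ} (hy : y ≠ 0)
    (h : ‖y - T.starProjection y‖ ≤ δ * ‖y‖) :
    angle y (T.starProjection y) ≤ Real.pi / 2 * δ := by
  set w := T.starProjection y with hw
  have horth : inner ℝ w (y - w) = (0 : ℝ) :=
    Submodule.inner_right_of_mem_orthogonal (T.starProjection_apply_mem y)
      (T.sub_starProjection_mem_orthogonal y)
  have hyw : w + (y - w) = y := by abel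
  have hne : w ≠ 0 ∨ y - w ≠ 0 := by
    by_contra! hcon
    exact hy ((sub_eq_zero.1 hcon.2).trans hcon.1)
  have hsin := sin_angle_add_of_inner_eq_zero horth hne
  have hle := angle_add_le_pi_div_two_of_inner_eq_zero horth
  rw [hyw] at hsin hle
  have hpos : 0 < ‖y‖ := norm_pos_iff.2 hy
  -- Right triangle with hypotenuse `y`: the sine of the angle is `‖y - w‖ / ‖y‖`, and Jordan's
  -- inequality `2t/π ≤ sin t` on `[0, π/2]` turns this into a bound on the angle.
  have h1 := Real.mul_le_sin (angle_nonneg w y) hle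
  have h2 : ‖y - w‖ / ‖y‖ ≤ δ := (div_le_iff₀ hpos).2 h
  rw [angle_comm]
  have hpi := Real.pi_pos
  have h3 : 2 / Real.pi * angle w y ≤ δ := by linarith
  calc angle w y = Real.pi / 2 * (2 / Real.pi * angle w y) := by field_simp
    _ ≤ _ := by gcongr

/-- No nonvanishing is needed: at a zero vector both sides take the default value `π/2`. -/
lemma arccos_inner_unitVector {m : ℕ} (x y : EuclideanSpace ℝ (Fin m)) :
    Real.arccos (inner ℝ (unitVector x) (unitVector y)) = angle x y := by
  unfold unitVector angle
  rw [real_inner_smul_left, real_inner_smul_right]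
  congr 1
  rw [div_eq_mul_inv, mul_inv]
  ring

lemma abs_angle_sub_pi_div_two_le {E : Type*} [NormedAddCommGroup E] [InnerProductSpace ℝ E]
    (x y : E) : |angle x y - Real.pi / 2| ≤ Real.pi / 2 := by
  have := angle_nonneg x y
  have := angle_le_pi x y
  rw [abs_le]
  constructor <;> linarith

/-- A normalized sum over pairs is bounded by four times a bound on its terms. -/
lemma abs_pairSum_le {k : ℕ} {S : Finset ℕ} (hS : S.card ≤ k) {f : ℕ → ℕ → ℝ} {B : ℝ}
    (hB : 0 ≤ B) (hf : ∀ i ∈ S, ∀ j ∈ S, |f i j| ≤ B) :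
    |1 / (k.choose 2 : ℝ) * ∑ i ∈ S, ∑ j ∈ S with i < j, f i j| ≤ 4 * B := by
  have h1 : |∑ i ∈ S, ∑ j ∈ S with i < j, f i j| ≤ (k : ℝ) ^ 2 * B := by
    calc |∑ i ∈ S, ∑ j ∈ S with i < j, f i j|
        ≤ ∑ i ∈ S, ∑ j ∈ S, B := by
          refine (Finset.abs_sum_le_sum_abs _ _).trans (Finset.sum_le_sum fun i hi => ?_)
          refine (Finset.abs_sum_le_sum_abs _ _).trans ?_
          refine (Finset.sum_le_sum_of_subset_of_nonneg (Finset.filter_subset _ _)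
            fun _ _ _ => abs_nonneg _).trans (Finset.sum_le_sum fun j hj => hf i hi j hj)
      _ = (S.card : ℝ) ^ 2 * B := by simp; ring
      _ ≤ _ := by gcongr
  rw [abs_mul, abs_of_nonneg (by positivity)]
  rcases lt_or_ge k 2 with hk | hk
  · rw [Nat.choose_eq_zero_of_lt hk]
    simpa using hB
  · have hk' : (2 : ℝ) ≤ k := by exact_mod_cast hk
    have hpos : 0 < (k.choose 2 : ℝ) := by exact_mod_cast Nat.choose_pos hk
    -- Source of the factor four: `k² ≤ 2k(k - 1)` exactly because `k ≥ 2`.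
    have hch : (k : ℝ) ^ 2 ≤ 4 * (k.choose 2 : ℝ) := by
      rw [Nat.cast_choose_two]
      nlinarith
    rw [one_div, inv_mul_le_iff₀ hpos]
    calc _ ≤ _ := h1
      _ ≤ 4 * (k.choose 2 : ℝ) * B := by gcongr
      _ = _ := by ring

lemma abs_angleStatistic_le {m k : ℕ} {S : Finset ℕ} (hS : S.card ≤ k)
    (y : ℕ → EuclideanSpace ℝ (Fin m)) :
    |angleStatistic k S y| ≤ 4 * (Real.pi / 2) ^ 2 := by
  refine abs_pairSum_le hS (by positivity) fun i _ j _ => ?_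
  rw [arccos_inner_unitVector, abs_pow]
  gcongr
  exact abs_angle_sub_pi_div_two_le _ _

/-- Projecting vectors that are close to `T` changes the angle statistic only a little. -/
lemma abs_angleStatistic_sub_le {m k : ℕ} {S : Finset ℕ} (hS : S.card ≤ k)
    (T : Submodule ℝ (EuclideanSpace ℝ (Fin m))) (y : ℕ → EuclideanSpace ℝ (Fin m)) {δ : ℝ}
    (hδ : 0 ≤ δ) (h : ∀ i ∈ S, ‖y i - T.starProjection (y i)‖ ≤ δ * ‖y i‖) :
    |angleStatistic k S y - angleStatistic k S fun i => T.starProjection (y i)|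
      ≤ 4 * (Real.pi ^ 2 * δ) := by
  have hpi := Real.pi_pos
  unfold angleStatistic
  rw [← mul_sub, ← Finset.sum_sub_distrib]
  simp_rw [← Finset.sum_sub_distrib]
  refine abs_pairSum_le hS (by positivity) fun i hi j hj => ?_
  simp_rw [arccos_inner_unitVector]
  -- The angle between `0` and its projection is `π/2`, not small, so zero vectors are separate;
  -- there both terms of the pair coincide.
  rcases eq_or_ne (y i) 0 with h0 | h0
  · simp only [h0, map_zero, angle_zero_left, sub_self, abs_zero]
    positivity
  rcases eq_or_ne (y j) 0 with h0' | h0'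
  · simp only [h0', map_zero, angle_zero_right, sub_self, abs_zero]
    positivity
  calc _ ≤ 2 * (Real.pi / 2) * |(angle (y i) (y j) - Real.pi / 2) -
        (angle (T.starProjection (y i)) (T.starProjection (y j)) - Real.pi / 2)| :=
        abs_sq_sub_sq_le (abs_angle_sub_pi_div_two_le _ _) (abs_angle_sub_pi_div_two_le _ _)
    _ ≤ 2 * (Real.pi / 2) * (Real.pi / 2 * δ + Real.pi / 2 * δ) := by
        gcongr
        rw [sub_sub_sub_cancel_right]
        exact (abs_angle_sub_angle_le _ _ _ _).trans (add_le_add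
          (angle_starProjection_le T h0 (h i hi)) (angle_starProjection_le T h0' (h j hj)))
    _ = _ := by ring

lemma measurable_angleStatistic {Ω : Type*} [MeasurableSpace Ω] {m : ℕ} (k : ℕ) (S : Finset ℕ)
    {y : ℕ → Ω → EuclideanSpace ℝ (Fin m)} (hy : ∀ i, Measurable (y i)) :
    Measurable fun ω => angleStatistic k S fun i => y i ω := by
  have hu : ∀ i, Measurable fun ω => unitVector (y i ω) := fun i =>
    (hy i).norm.inv.smul (hy i)
  unfold angleStatistic
  refine measurable_const.mul (Finset.measurable_fun_sum _ fun i _ =>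
    Finset.measurable_fun_sum _ fun j _ => ?_)
  exact ((Real.continuous_arccos.measurable.comp ((hu i).inner (hu j))).sub_const _).pow_const 2

/-- A quantity indexed by a random finite subset of a fixed finite set is measurable. -/
lemma measurable_of_random_subset {Ω : Type*} [MeasurableSpace Ω] {N : Ω → Finset ℕ} {n : ℕ}
    (hN : ∀ S : Finset ℕ, MeasurableSet {ω | N ω = S}) (hsub : ∀ ω, N ω ⊆ Finset.range n)
    {f : Finset ℕ → Ω → ℝ} (hf : ∀ S, Measurable (f S)) :
    Measurable fun ω => f (N ω) ω := by
  have h : (fun ω => f (N ω) ω) = fun ω => ∑ S ∈ (Finset.range n).powerset,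
      {ω | N ω = S}.indicator (f S) ω := by
    funext ω
    rw [Finset.sum_eq_single (N ω)]
    · simp
    · intro S _ hS
      exact Set.indicator_of_notMem (fun h => hS h.symm) _
    · intro hω
      exact absurd (Finset.mem_powerset.2 (hsub ω)) hω
  rw [h]
  exact Finset.measurable_fun_sum _ fun S _ => (hf S).indicator (hN S)

end AngleVariance

/-! ### Second-order contact of the submanifold with its tangent space -/

namespace AngleVariance

namespace IsC2Param

variable {m d : ℕ} {M : Set (EuclideanSpace ℝ (Fin m))}
  {φ : EuclideanSpace ℝ (Fin d) → EuclideanSpace ℝ (Fin m)}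
  {V : Set (EuclideanSpace ℝ (Fin d))} {v₀ : EuclideanSpace ℝ (Fin d)}

lemma contDiffAt (h : IsC2Param d M φ V) (hv : v₀ ∈ V) : ContDiffAt ℝ 2 φ v₀ :=
  h.contDiffOn.contDiffAt (h.isOpen_domain.mem_nhds hv)

lemma hasFDerivAt (h : IsC2Param d M φ V) (hv : v₀ ∈ V) : HasFDerivAt φ (fderiv ℝ φ v₀) v₀ :=
  ((h.contDiffAt hv).differentiableAt (by norm_num)).hasFDerivAt

lemma image_subset (h : IsC2Param d M φ V) : φ '' V ⊆ M := by
  obtain ⟨U, _, hU⟩ := h.image_open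
  rw [hU]
  exact Set.inter_subset_left

lemma aemeasurable (h : IsC2Param d M φ V) :
    AEMeasurable φ
      ((volume.restrict V).withDensity fun v => ENNReal.ofReal (volumeDensity φ v)) :=
  (h.contDiffOn.continuousOn.aemeasurable h.isOpen_domain.measurableSet).mono_ac
    (withDensity_absolutelyContinuous _ _)

lemma measurableSet_image (h : IsC2Param d M φ V) : MeasurableSet (φ '' V) :=
  h.isOpen_domain.measurableSet.image_of_continuousOn_injOn h.contDiffOn.continuousOn
    (Set.injOn_iff_injective.2 h.isEmbedding.injective)

/-- The tangent space contains the image of the derivative of a parametrization. -/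
lemma fderiv_mem_tangentSpaceAt (h : IsC2Param d M φ V) (hv : v₀ ∈ V)
    (w : EuclideanSpace ℝ (Fin d)) : fderiv ℝ φ v₀ w ∈ tangentSpaceAt M (φ v₀) := by
  refine Submodule.subset_span (tangentConeAt_mono h.image_subset
    ((h.hasFDerivAt hv).hasFDerivWithinAt.mapsTo_tangent_cone ?_))
  rw [tangentConeAt_of_mem_nhds (h.isOpen_domain.mem_nhds hv)]
  trivial

/-- The derivative is `C¹`, hence locally Lipschitz. On the ball of radius `‖v - v₀‖` it differs
from its value at `v₀` by at most `K‖v - v₀‖`, and the mean value inequality supplies the second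
factor. -/
lemma eventually_quadratic_approx (h : IsC2Param d M φ V) (hv : v₀ ∈ V) :
    ∃ K : ℝ, 0 ≤ K ∧ ∀ᶠ v in 𝓝 v₀,
      ‖φ v - φ v₀ - fderiv ℝ φ v₀ (v - v₀)‖ ≤ K * ‖v - v₀‖ ^ 2 := by
  obtain ⟨K, t, ht, hK⟩ :=
    ((h.contDiffAt hv).fderiv_right (m := 1) (by norm_num)).exists_lipschitzOnWith
  obtain ⟨ρ, hρ, hball⟩ := Metric.mem_nhds_iff.1
    (Filter.inter_mem ht (h.isOpen_domain.mem_nhds hv))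
  refine ⟨K, K.2, ?_⟩
  filter_upwards [Metric.ball_mem_nhds v₀ hρ] with v hvρ
  have hsub : Metric.closedBall v₀ ‖v - v₀‖ ⊆ t ∩ V := fun u hu => by
    refine hball (Metric.mem_ball.2 ((Metric.mem_closedBall.1 hu).trans_lt ?_))
    rwa [← dist_eq_norm]
  have := Convex.norm_image_sub_le_of_norm_hasFDerivWithin_le' (f := φ) (f' := fderiv ℝ φ)
    (C := K * ‖v - v₀‖) (φ := fderiv ℝ φ v₀) (s := Metric.closedBall v₀ ‖v - v₀‖)
    (x := v₀) (y := v)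
    (fun x hx => (h.hasFDerivAt (hsub hx).2).hasFDerivWithinAt)
    (fun x hx => by
      rw [← dist_eq_norm]
      refine (hK.dist_le_mul x (hsub hx).1 v₀ (mem_of_mem_nhds ht)).trans ?_
      have : dist x v₀ ≤ ‖v - v₀‖ := hx
      gcongr)
    (convex_closedBall _ _) (Metric.mem_closedBall_self (norm_nonneg _))
    (by simp [dist_eq_norm])
  rwa [mul_assoc, ← sq] at this

end IsC2Param

lemma norm_sub_starProjection_le_of_mem {E : Type*} [NormedAddCommGroup E]
    [InnerProductSpace ℝ E] (T : Submodule ℝ E) [T.HasOrthogonalProjection] (y : E) {z : E}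
    (hz : z ∈ T) : ‖y - T.starProjection y‖ ≤ ‖y - z‖ := by
  rw [T.starProjection_minimal]
  exact ciInf_le ⟨0, by rintro _ ⟨x, rfl⟩; exact norm_nonneg _⟩ (⟨z, hz⟩ : T)

/-- The distance to the tangent space is quadratically small on the submanifold. -/
lemma IsC2Param.exists_norm_sub_starProjection_le {m d : ℕ}
    {M : Set (EuclideanSpace ℝ (Fin m))}
    {φ : EuclideanSpace ℝ (Fin d) → EuclideanSpace ℝ (Fin m)}
    {V : Set (EuclideanSpace ℝ (Fin d))} {v₀ : EuclideanSpace ℝ (Fin d)}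
    (h : IsC2Param d M φ V) (hv : v₀ ∈ V) :
    ∃ K r : ℝ, 0 ≤ K ∧ 0 < r ∧ ∀ x ∈ φ '' V, dist x (φ v₀) < r →
      ‖x - φ v₀ - (tangentSpaceAt M (φ v₀)).starProjection (x - φ v₀)‖
        ≤ K * ‖x - φ v₀‖ ^ 2 := by
  obtain ⟨K, hK, hquad⟩ := h.eventually_quadratic_approx hv
  obtain ⟨a, ha, hanti⟩ := (fderiv ℝ φ v₀).toLinearMap.exists_antilipschitzWith
    (LinearMap.ker_eq_bot.2 (h.injective_fderiv v₀ hv))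
  have ha' : (0 : ℝ) < a := ha
  have hsmall : ∀ᶠ v in 𝓝 v₀, a * (K * ‖v - v₀‖) < 1 / 2 := by
    have : Tendsto (fun v => a * (K * ‖v - v₀‖)) (𝓝 v₀) (𝓝 (a * (K * ‖v₀ - v₀‖))) :=
      Continuous.tendsto (by fun_prop) v₀
    refine this.eventually_lt_const ?_
    simp
  -- The embedding property is essential here: closeness of `φ v` to `φ v₀` in the ambient space
  -- must force `v` to be close to `v₀`.
  have hnhds := h.isEmbedding.isInducing.nhds_eq_comap ⟨v₀, hv⟩
  have hmem : Subtype.val ⁻¹' {v | ‖φ v - φ v₀ - fderiv ℝ φ v₀ (v - v₀)‖ ≤ K * ‖v - v₀‖ ^ 2 ∧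
      a * (K * ‖v - v₀‖) < 1 / 2} ∈ 𝓝 (⟨v₀, hv⟩ : V) :=
    continuous_subtype_val.continuousAt.preimage_mem_nhds (hquad.and hsmall)
  rw [hnhds] at hmem
  obtain ⟨t, ht, htsub⟩ := Filter.mem_comap.1 hmem
  obtain ⟨r, hr, hball⟩ := Metric.mem_nhds_iff.1 ht
  refine ⟨K * (2 * a) ^ 2, r, by positivity, hr, ?_⟩
  rintro _ ⟨v, hvV, rfl⟩ hdist
  obtain ⟨h1, h2⟩ := htsub (show (⟨v, hvV⟩ : V) ∈ _ from hball hdist)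
  simp only at h1 h2
  have h3 : ‖v - v₀‖ ≤ a * ‖fderiv ℝ φ v₀ (v - v₀)‖ := by
    have := hanti.le_mul_dist (v - v₀) 0
    simpa using this
  have h4 : ‖fderiv ℝ φ v₀ (v - v₀)‖ ≤ ‖φ v - φ v₀‖ + K * ‖v - v₀‖ ^ 2 := by
    have := norm_sub_norm_le (fderiv ℝ φ v₀ (v - v₀)) (φ v - φ v₀)
    rw [norm_sub_rev (fderiv ℝ φ v₀ (v - v₀))] at this
    linarith
  -- The quadratic error is absorbed into half of the left side, so parameter distances are
  -- controlled by ambient ones.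
  have h5 : ‖v - v₀‖ ≤ 2 * a * ‖φ v - φ v₀‖ := by
    have h6 : a * ‖fderiv ℝ φ v₀ (v - v₀)‖ ≤ a * (‖φ v - φ v₀‖ + K * ‖v - v₀‖ ^ 2) := by
      gcongr
    have h7 : a * (K * ‖v - v₀‖) * ‖v - v₀‖ ≤ 1 / 2 * ‖v - v₀‖ := by gcongr
    nlinarith
  calc _ ≤ ‖φ v - φ v₀ - fderiv ℝ φ v₀ (v - v₀)‖ :=
        norm_sub_starProjection_le_of_mem _ _ (h.fderiv_mem_tangentSpaceAt hv _)
    _ ≤ K * ‖v - v₀‖ ^ 2 := h1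
    _ ≤ K * (2 * a * ‖φ v - φ v₀‖) ^ 2 := by gcongr
    _ = _ := by ring

/-! ### The volume measure and the mass of small balls -/

lemma volumeMeasure_eq_zero_of_disjoint {m d : ℕ} {M E : Set (EuclideanSpace ℝ (Fin m))}
    (hE : MeasurableSet E) (hEM : Disjoint E M) : volumeMeasure d M E = 0 := by
  -- A supremum of measures is not computed set by set. Instead, the restriction to `Eᶜ` is still an
  -- upper bound of the family, so it dominates the supremum.
  have hle : volumeMeasure d M ≤ (volumeMeasure d M).restrict Eᶜ := by
    refine sSup_le ?_
    rintro _ ⟨ψ, W, hψ, rfl⟩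
    have h0 : paramVolume ψ W E = 0 := by
      unfold paramVolume
      rw [Measure.map_apply_of_aemeasurable hψ.aemeasurable hE]
      refine withDensity_absolutelyContinuous _ _ ?_
      rw [Measure.restrict_apply' hψ.isOpen_domain.measurableSet]
      convert measure_empty (μ := volume)
      ext v
      simp only [Set.mem_inter_iff, Set.mem_preimage, Set.mem_empty_iff_false, iff_false, not_and]
      exact fun hvE hvW => Set.disjoint_left.1 hEM hvE (hψ.image_subset ⟨v, hvW, rfl⟩)
    calc paramVolume ψ W = (paramVolume ψ W).restrict Eᶜ :=
          (Measure.restrict_eq_self_of_ae_mem (measure_eq_zero_iff_ae_notMem.1 h0)).symm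
      _ ≤ _ := Measure.restrict_mono subset_rfl
          (le_sSup (show _ ∈ {ν | ∃ φ V, IsC2Param d M φ V ∧ ν = paramVolume φ V} from
            ⟨ψ, W, hψ, rfl⟩))
  refine le_antisymm ((hle E).trans ?_) zero_le
  rw [Measure.restrict_apply hE]
  simp

/-- Since the piece is relatively open in `M`, a small ball minus the piece misses `M`, hence is
null. `M` itself need not be measurable; the piece is, as an injective continuous image of an open
set. -/
lemma HasLipschitzDensityNear.ae_mem_image {m d : ℕ} {M : Set (EuclideanSpace ℝ (Fin m))}
    {P : Measure (EuclideanSpace ℝ (Fin m))} {p : EuclideanSpace ℝ (Fin m)}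
    (hP : HasLipschitzDensityNear d M P p)
    {φ : EuclideanSpace ℝ (Fin d) → EuclideanSpace ℝ (Fin m)}
    {V : Set (EuclideanSpace ℝ (Fin d))} (h : IsC2Param d M φ V) (hp : p ∈ φ '' V) :
    ∃ r > 0, ∀ᵐ x ∂P, dist x p < r → x ∈ φ '' V := by
  obtain ⟨U, g, L, hU, hpU, -, -, hPU⟩ := hP
  obtain ⟨U', hU', himg⟩ := h.image_open
  obtain ⟨r, hr, hball⟩ := Metric.mem_nhds_iff.1
    (Filter.inter_mem (hU.mem_nhds hpU) (hU'.mem_nhds (himg ▸ hp).2))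
  refine ⟨r, hr, ?_⟩
  set E := Metric.ball p r \ φ '' V
  have hE : MeasurableSet E := Metric.isOpen_ball.measurableSet.diff h.measurableSet_image
  have hEU : E ⊆ U := fun x hx => (hball hx.1).1
  have hEM : Disjoint E M := Set.disjoint_left.2 fun x hx hxM =>
    hx.2 (himg ▸ ⟨hxM, (hball hx.1).2⟩)
  have h0 : P E = 0 := by
    rw [← Measure.restrict_eq_self P hEU, hPU, Measure.restrict_eq_self _ hEU]
    exact withDensity_absolutelyContinuous _ _ (volumeMeasure_eq_zero_of_disjoint hE hEM)
  filter_upwards [measure_eq_zero_iff_ae_notMem.1 h0] with x hx hdist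
  by_contra hxV
  exact hx ⟨hdist, hxV⟩

/-- Almost every point near `p` is quadratically close to the tangent space at `p`. -/
lemma HasLipschitzDensityNear.ae_norm_sub_starProjection_le {m d : ℕ}
    {M : Set (EuclideanSpace ℝ (Fin m))}
    {P : Measure (EuclideanSpace ℝ (Fin m))} {p : EuclideanSpace ℝ (Fin m)}
    (hP : HasLipschitzDensityNear d M P p) (hM : IsC2SubmanifoldAt d M p) :
    ∃ K r : ℝ, 0 ≤ K ∧ 0 < r ∧ ∀ᵐ x ∂P, dist x p < r →
      ‖x - p - (tangentSpaceAt M p).starProjection (x - p)‖ ≤ K * ‖x - p‖ ^ 2 := by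
  obtain ⟨φ, V, h, hp⟩ := hM
  obtain ⟨r₁, hr₁, hae⟩ := hP.ae_mem_image h hp
  obtain ⟨v₀, hv₀, rfl⟩ := hp
  obtain ⟨K, r₂, hK, hr₂, hle⟩ := h.exists_norm_sub_starProjection_le hv₀
  refine ⟨K, min r₁ r₂, hK, lt_min hr₁ hr₂, ?_⟩
  filter_upwards [hae] with x hx hdist
  exact hle x (hx (hdist.trans_le (min_le_left _ _))) (hdist.trans_le (min_le_right _ _))

namespace IsC2Param

variable {m d : ℕ} {M : Set (EuclideanSpace ℝ (Fin m))}
  {φ : EuclideanSpace ℝ (Fin d) → EuclideanSpace ℝ (Fin m)}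
  {V : Set (EuclideanSpace ℝ (Fin d))} {v₀ : EuclideanSpace ℝ (Fin d)}

/-- The Gram matrix of the linearly independent partial derivatives is positive definite. -/
lemma volumeDensity_pos (h : IsC2Param d M φ V) (hv : v₀ ∈ V) : 0 < volumeDensity φ v₀ := by
  have hli : LinearIndependent ℝ fun i : Fin d => EuclideanSpace.single i (1 : ℝ) := by
    have heq : (fun i : Fin d => EuclideanSpace.single i (1 : ℝ)) =
        (EuclideanSpace.basisFun (Fin d) ℝ).toBasis := by
      funext i
      simp
    rw [heq]
    exact (EuclideanSpace.basisFun (Fin d) ℝ).toBasis.linearIndependent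
  have hli' := hli.map' (fderiv ℝ φ v₀).toLinearMap
    (LinearMap.ker_eq_bot.2 (h.injective_fderiv v₀ hv))
  exact Real.sqrt_pos.2 (Matrix.posDef_gram_of_linearIndependent hli').det_pos

lemma continuousAt_volumeDensity (h : IsC2Param d M φ V) (hv : v₀ ∈ V) :
    ContinuousAt (volumeDensity φ) v₀ := by
  have hf : ContinuousAt (fderiv ℝ φ) v₀ :=
    (h.contDiffOn.continuousOn_fderiv_of_isOpen h.isOpen_domain (by norm_num)).continuousAt
      (h.isOpen_domain.mem_nhds hv)
  have hmat : ContinuousAt (fun v => Matrix.of fun i j : Fin d =>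
      inner ℝ (fderiv ℝ φ v (EuclideanSpace.single i 1))
        (fderiv ℝ φ v (EuclideanSpace.single j 1))) v₀ := by
    refine continuousAt_pi.2 fun i => continuousAt_pi.2 fun j => ?_
    exact (hf.clm_apply continuousAt_const).inner (hf.clm_apply continuousAt_const)
  have hdet : Continuous fun A : Matrix (Fin d) (Fin d) ℝ => A.det :=
    continuous_id.matrix_det
  exact Real.continuous_sqrt.continuousAt.comp (hdet.continuousAt.comp hmat)

end IsC2Param

/-- Small balls around `p` of radius `r` have mass at least of the order `r ^ d`. -/
lemma HasLipschitzDensityNear.exists_le_measure_closedBall {m d : ℕ}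
    {M : Set (EuclideanSpace ℝ (Fin m))}
    {P : Measure (EuclideanSpace ℝ (Fin m))} {p : EuclideanSpace ℝ (Fin m)}
    (hP : HasLipschitzDensityNear d M P p) (hM : IsC2SubmanifoldAt d M p) :
    ∃ c r₀ : ℝ, 0 < c ∧ 0 < r₀ ∧ ∀ r, 0 < r → r ≤ r₀ →
      ENNReal.ofReal (c * r ^ d) ≤ P (Metric.closedBall p r) := by
  obtain ⟨φ, V, h, v₀, hv, rfl⟩ := hM
  obtain ⟨U, g, L, hU, hpU, hg, hgp, hPU⟩ := hP
  have hVn := h.isOpen_domain.mem_nhds hv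
  have hφc : ContinuousAt φ v₀ := (h.contDiffAt hv).continuousAt
  have hMU : ∀ᶠ v in 𝓝 v₀, φ v ∈ M ∩ U := by
    filter_upwards [hVn, hφc.preimage_mem_nhds (hU.mem_nhds hpU)] with v h1 h2
    exact ⟨h.image_subset ⟨v, h1, rfl⟩, h2⟩
  have hg' : ∀ᶠ v in 𝓝 v₀, g (φ v₀) / 2 < g (φ v) := by
    have h1 : Tendsto φ (𝓝 v₀) (𝓝[M ∩ U] (φ v₀)) :=
      tendsto_nhdsWithin_iff.2 ⟨hφc, hMU⟩
    exact (((hg.continuousOn _ hMU.self_of_nhds).tendsto).comp h1).eventually_const_lt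
      (NNReal.half_lt_self hgp)
  have hD := h.volumeDensity_pos hv
  have hvd : ∀ᶠ v in 𝓝 v₀, volumeDensity φ v₀ / 2 < volumeDensity φ v :=
    (h.continuousAt_volumeDensity hv).eventually_const_lt (half_lt_self hD)
  obtain ⟨K₀, t, ht, hK₀⟩ := ((h.contDiffAt hv).of_le (by norm_num)).exists_lipschitzOnWith
  obtain ⟨ρ, hρ, hball⟩ := Metric.nhds_basis_closedBall.mem_iff.1
    (hMU.and (hg'.and (hvd.and (Filter.inter_mem ht hVn))))
  -- Adding one keeps the constant positive, so that it can be inverted.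
  set K : ℝ := K₀ + 1
  have hK : 0 < K := by positivity
  have hlip : ∀ v ∈ Metric.closedBall v₀ ρ, dist (φ v) (φ v₀) ≤ K * dist v v₀ := fun v hvρ => by
    refine (hK₀.dist_le_mul v (hball hvρ).2.2.2.1 v₀ (mem_of_mem_nhds ht)).trans ?_
    gcongr
    simp [K]
  set Q := φ '' Metric.closedBall v₀ ρ
  have hQ : MeasurableSet Q := ((isCompact_closedBall v₀ ρ).image_of_continuousOn
    (h.contDiffOn.continuousOn.mono fun v hvρ => (hball hvρ).2.2.2.2)).measurableSet
  set b : ℝ≥0∞ := volume (Metric.ball (0 : EuclideanSpace ℝ (Fin d)) 1)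
  have hb : 0 < b := Metric.measure_ball_pos _ _ one_pos
  have hb' : b ≠ ∞ := measure_ball_lt_top.ne
  have hgp' : (0 : ℝ) < g (φ v₀) := by positivity
  refine ⟨g (φ v₀) / 2 * (volumeDensity φ v₀ / 2 * ((K⁻¹) ^ d * b.toReal)), K * ρ, ?_, by positivity,
    fun r hr hrρ => ?_⟩
  · have := ENNReal.toReal_pos hb.ne' hb'
    positivity
  set B := Metric.closedBall (φ v₀) r ∩ Q
  have hB : MeasurableSet B := Metric.isClosed_closedBall.measurableSet.inter hQ
  have hQ' : ∀ x ∈ Q, x ∈ U ∧ g (φ v₀) / 2 ≤ g x := by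
    rintro _ ⟨v, hvρ, rfl⟩
    exact ⟨(hball hvρ).1.2, (hball hvρ).2.1.le⟩
  have hBU : B ⊆ U := fun x hx => (hQ' x hx.2).1
  -- `φ` is `K`-Lipschitz about `v₀`, so it maps this parameter ball into the ball of radius `r`;
  -- the parameter ball has volume of order `r ^ d`.
  set s := Metric.ball v₀ (r * K⁻¹)
  have hsρ : s ⊆ Metric.closedBall v₀ ρ := fun v hvs => by
    refine Metric.mem_closedBall.2 ((Metric.mem_ball.1 hvs).le.trans ?_)
    rw [← div_eq_mul_inv, div_le_iff₀ hK]
    linarith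
  have hsB : s ⊆ φ ⁻¹' B := fun v hvs => by
    refine ⟨(hlip v (hsρ hvs)).trans ?_, v, hsρ hvs, rfl⟩
    calc K * dist v v₀ ≤ K * (r * K⁻¹) := by gcongr; exact (Metric.mem_ball.1 hvs).le
      _ = r := by field_simp
  have hsV : s ⊆ V := fun v hvs => (hball (hsρ hvs)).2.2.2.2
  have hs : MeasurableSet s := Metric.isOpen_ball.measurableSet
  have hvol : volume s = ENNReal.ofReal ((r * K⁻¹) ^ d) * b := by
    rw [Measure.addHaar_ball_of_pos _ _ (by positivity), finrank_euclideanSpace_fin]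
  have hparam : ENNReal.ofReal (volumeDensity φ v₀ / 2) * volume s ≤ paramVolume φ V B := by
    calc ENNReal.ofReal (volumeDensity φ v₀ / 2) * volume s
        = ∫⁻ _ in s, ENNReal.ofReal (volumeDensity φ v₀ / 2) ∂(volume.restrict V) := by
          rw [setLIntegral_const, Measure.restrict_eq_self _ hsV]
      _ ≤ ∫⁻ v in s, ENNReal.ofReal (volumeDensity φ v) ∂(volume.restrict V) :=
          setLIntegral_mono' hs fun v hvs =>
            ENNReal.ofReal_le_ofReal (hball (hsρ hvs)).2.2.1.le
      _ = ((volume.restrict V).withDensity fun v => ENNReal.ofReal (volumeDensity φ v)) s :=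
          (withDensity_apply _ hs).symm
      _ ≤ _ := measure_mono hsB
      _ ≤ _ := Measure.le_map_apply h.aemeasurable _
  calc ENNReal.ofReal (g (φ v₀) / 2 * (volumeDensity φ v₀ / 2 * ((K⁻¹) ^ d * b.toReal)) * r ^ d)
      = ENNReal.ofReal (g (φ v₀) / 2) *
          (ENNReal.ofReal (volumeDensity φ v₀ / 2) * volume s) := by
        rw [hvol]
        nth_rewrite 2 [← ENNReal.ofReal_toReal hb']
        rw [← ENNReal.ofReal_mul (by positivity), ← ENNReal.ofReal_mul (by positivity),
          ← ENNReal.ofReal_mul (by positivity)]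
        congr 1
        ring
    _ ≤ ENNReal.ofReal (g (φ v₀) / 2) * volumeMeasure d M B := by
        gcongr
        exact hparam.trans ((le_sSup ⟨φ, V, h, rfl⟩ : paramVolume φ V ≤ volumeMeasure d M) B)
    _ = ∫⁻ _ in B, ENNReal.ofReal (g (φ v₀) / 2) ∂(volumeMeasure d M) :=
        (setLIntegral_const _ _).symm
    _ ≤ ∫⁻ x in B, g x ∂(volumeMeasure d M) := by
        refine setLIntegral_mono' hB fun x hx => ?_
        rw [← ENNReal.ofReal_coe_nnreal]
        exact ENNReal.ofReal_le_ofReal (by exact_mod_cast (hQ' x hx.2).2)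
    _ = P B := by
        rw [← withDensity_apply _ hB, ← Measure.restrict_eq_self P hBU, hPU,
          Measure.restrict_eq_self _ hBU]
    _ ≤ _ := measure_mono Set.inter_subset_left

end AngleVariance

/-! ### Counting sample points and growth of the number of neighbours -/

namespace AngleVariance

lemma IsNearestNeighbors.card_le {m : ℕ} {p : EuclideanSpace ℝ (Fin m)}
    {x : ℕ → EuclideanSpace ℝ (Fin m)} {n k : ℕ} {S : Finset ℕ}
    (h : IsNearestNeighbors p x n k S) : S.card ≤ k :=
  h.2.1.trans_le (min_le_left _ _)

open Classical in
/-- If at least `k` points lie in a ball, then so do the `k` nearest neighbours of the centre. -/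
lemma IsNearestNeighbors.dist_le {m : ℕ} {p : EuclideanSpace ℝ (Fin m)}
    {x : ℕ → EuclideanSpace ℝ (Fin m)} {n k : ℕ} {S : Finset ℕ}
    (h : IsNearestNeighbors p x n k S) {r : ℝ}
    (hk : k ≤ ((Finset.range n).filter fun i => x i ∈ Metric.closedBall p r).card) {i : ℕ}
    (hi : i ∈ S) : dist (x i) p ≤ r := by
  by_contra! hlt
  -- A selected point outside the ball forces every index in the ball to be selected too, leaving
  -- room for at most `k - 1` of them.
  have hsub : ((Finset.range n).filter fun i => x i ∈ Metric.closedBall p r) ⊆ S.erase i := by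
    intro j hj
    obtain ⟨hjn, hjr⟩ := Finset.mem_filter.1 hj
    have hjr' : dist (x j) p ≤ r := hjr
    refine Finset.mem_erase.2 ⟨fun hji => ?_, ?_⟩
    · rw [hji] at hjr'
      linarith
    · by_contra hjS
      have := h.2.2 i hi j hjn hjS
      linarith
  have h1 := Finset.card_le_card hsub
  have h2 := Finset.card_erase_lt_of_mem hi
  have h3 := h.card_le
  omega

open Classical in
/-- A binomial random variable with mean `n q` is rarely below half its mean. -/
lemma measure_card_filter_lt_le {Ω α : Type*} [MeasurableSpace Ω] [MeasurableSpace α]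
    {μ : Measure Ω} [IsProbabilityMeasure μ] {P : Measure α} {X : ℕ → Ω → α}
    (hX_meas : ∀ i, Measurable (X i)) (hX_law : ∀ i, μ.map (X i) = P) (hX_indep : iIndepFun X μ)
    {B : Set α} (hB : MeasurableSet B) {n k : ℕ} {a : ℝ} (ha : 0 < a) (hka : 2 * k ≤ a)
    (haq : a ≤ n * P.real B) :
    μ {ω | ((Finset.range n).filter fun i => X i ω ∈ B).card < k} ≤ ENNReal.ofReal (4 / a) := by
  set f : α → ℝ := B.indicator 1
  have hf : Measurable f := measurable_one.indicator hB
  have hf01 : ∀ x, f x = 0 ∨ f x = 1 := fun x => by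
    by_cases hx : x ∈ B <;> simp [f, hx]
  set Y : ℕ → Ω → ℝ := fun i ω => f (X i ω)
  have hYm : ∀ i, Measurable (Y i) := fun i => hf.comp (hX_meas i)
  have hYb : ∀ i, MemLp (Y i) 2 μ := fun i =>
    MemLp.of_bound (hYm i).aestronglyMeasurable 1 (ae_of_all _ fun ω => by
      rcases hf01 (X i ω) with h | h <;> simp [Y, h])
  have hmean : ∀ i, ∫ ω, Y i ω ∂μ = P.real B := fun i => by
    rw [← integral_map (hX_meas i).aemeasurable hf.aestronglyMeasurable, hX_law i]
    exact integral_indicator_one hB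
  -- An indicator equals its square, so its second moment is its mean.
  have hvar : ∀ i, variance (Y i) μ ≤ P.real B := fun i => by
    refine (variance_le_expectation_sq (hYm i).aestronglyMeasurable).trans_eq ?_
    rw [← hmean i]
    refine integral_congr_ae (ae_of_all _ fun ω => ?_)
    rcases hf01 (X i ω) with h | h <;> simp [Y, h]
  set q := P.real B
  set Z : Ω → ℝ := ∑ i ∈ Finset.range n, Y i
  have hZ : MemLp Z 2 μ := memLp_finsetSum' _ fun i _ => hYb i
  have hZmean : ∫ ω, Z ω ∂μ = n * q := by
    simp only [Z, Finset.sum_apply]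
    rw [integral_finsetSum _ fun i _ => (hYb i).integrable (by norm_num)]
    simp [hmean]
  have hZvar : variance Z μ ≤ n * q := by
    rw [IndepFun.variance_sum (fun i _ => hYb i)
      fun i _ j _ hij => (hX_indep.indepFun hij).comp hf hf]
    exact (Finset.sum_le_sum fun i _ => hvar i).trans_eq (by simp)
  have hnq : 0 < n * q := ha.trans_le haq
  have hcount : ∀ ω, (((Finset.range n).filter fun i => X i ω ∈ B).card : ℝ) = Z ω := fun ω => by
    simp [Z, Y, f, Set.indicator_apply, Finset.sum_boole]
  calc μ {ω | ((Finset.range n).filter fun i => X i ω ∈ B).card < k}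
      ≤ μ {ω | n * q / 2 ≤ |Z ω - ∫ ω, Z ω ∂μ|} := by
        refine measure_mono fun ω hω => ?_
        have h1 : Z ω < k := by
          rw [← hcount ω]
          exact_mod_cast (show _ < k from hω)
        -- Since `k ≤ a/2 ≤ nq/2`, a count below `k` deviates from its mean `nq` by at least `nq/2`.
        rw [Set.mem_ofPred_eq, hZmean, abs_sub_comm]
        refine le_trans ?_ (le_abs_self _)
        linarith
    _ ≤ ENNReal.ofReal (variance Z μ / (n * q / 2) ^ 2) :=
        meas_ge_le_variance_div_sq hZ (by positivity)
    _ ≤ ENNReal.ofReal (4 / a) := by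
        refine ENNReal.ofReal_le_ofReal ?_
        calc variance Z μ / (n * q / 2) ^ 2 ≤ n * q / (n * q / 2) ^ 2 := by gcongr
          _ = 4 / (n * q) := by
            have := hnq.ne'
            generalize (n : ℝ) * q = z at *
            field_simp
            norm_num
          _ ≤ 4 / a := by gcongr

lemma tendsto_numNeighbors {C : ℝ} (hC : 0 < C) :
    Tendsto (fun n => (numNeighbors C n : ℝ)) atTop atTop := by
  refine tendsto_atTop_mono (fun n => Nat.le_ceil _) ?_
  exact (Real.tendsto_log_atTop.comp tendsto_natCast_atTop_atTop).const_mul_atTop hC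

/-- The number of neighbours is `O(log n)`, and every power of `log n` is `o(n)`. -/
lemma tendsto_div_numNeighbors_pow {C : ℝ} (hC : 0 < C) (e : ℕ) :
    Tendsto (fun n : ℕ => (n : ℝ) / (numNeighbors C n : ℝ) ^ e) atTop atTop := by
  have hlog : Tendsto (fun n : ℕ => Real.log n) atTop atTop :=
    Real.tendsto_log_atTop.comp tendsto_natCast_atTop_atTop
  have hO : (fun n => (numNeighbors C n : ℝ)) =O[atTop] fun n : ℕ => Real.log n := by
    refine Asymptotics.IsBigO.of_bound (C + 1) ?_
    filter_upwards [hlog.eventually_ge_atTop 1] with n hn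
    rw [Real.norm_of_nonneg (by positivity), Real.norm_of_nonneg (by linarith)]
    have := (Nat.ceil_lt_add_one (show 0 ≤ C * Real.log n by positivity)).le
    unfold numNeighbors
    linarith
  have ho : (fun n => (numNeighbors C n : ℝ) ^ e) =o[atTop] fun n : ℕ => (n : ℝ) :=
    (hO.pow e).trans_isLittleO
      (Real.isLittleO_pow_log_id_atTop.comp_tendsto tendsto_natCast_atTop_atTop)
  have h0 : Tendsto (fun n : ℕ => (numNeighbors C n : ℝ) ^ e / n) atTop (𝓝[>] 0) := by
    refine tendsto_nhdsWithin_iff.2 ⟨ho.tendsto_div_nhds_zero, ?_⟩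
    filter_upwards [(tendsto_numNeighbors hC).eventually_gt_atTop 0, eventually_gt_atTop 0]
      with n h1 h2
    have : (0 : ℝ) < n := by exact_mod_cast h2
    exact div_pos (pow_pos h1 e) this
  refine (tendsto_inv_nhdsGT_zero.comp h0).congr fun n => ?_
  simp

/-- Bounded convergence for a sequence that converges to zero in measure. -/
lemma tendsto_integral_of_tendstoInMeasure_of_bounded {Ω : Type*} [MeasurableSpace Ω]
    {μ : Measure Ω} [IsProbabilityMeasure μ] {Z : ℕ → Ω → ℝ} {B : ℝ}
    (hZ : ∀ n, Measurable (Z n)) (hB : ∀ n ω, |Z n ω| ≤ B)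
    (hlim : TendstoInMeasure μ Z atTop fun _ => 0) :
    Tendsto (fun n => ∫ ω, Z n ω ∂μ) atTop (𝓝 0) := by
  rw [Metric.tendsto_atTop']
  intro ε hε
  have h1 := (tendstoInMeasure_iff_measureReal_norm.1 hlim) (ε / 2) (by positivity)
  simp only [sub_zero] at h1
  have h2 : Tendsto (fun n => ε / 2 + B * μ.real {ω | ε / 2 ≤ ‖Z n ω‖}) atTop
      (𝓝 (ε / 2 + B * 0)) := (h1.const_mul B).const_add _
  obtain ⟨n₀, hn₀⟩ := eventually_atTop.1 (h2.eventually_lt_const (u := ε) (by linarith))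
  refine ⟨n₀, fun n hn => ?_⟩
  have hA : MeasurableSet {ω | ε / 2 ≤ ‖Z n ω‖} := measurableSet_le measurable_const (hZ n).norm
  refine lt_of_le_of_lt ?_ (hn₀ n hn.le)
  rw [dist_zero_right]
  calc ‖∫ ω, Z n ω ∂μ‖
      -- Below the threshold the integrand is at most `ε/2`; above it, at most `B` on an event of
      -- vanishing probability.
      ≤ ∫ ω, (ε / 2 + {ω | ε / 2 ≤ ‖Z n ω‖}.indicator (fun _ => B) ω) ∂μ := by
        refine norm_integral_le_of_norm_le
          ((integrable_const _).add ((integrable_const _).indicator hA)) (ae_of_all _ fun ω => ?_)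
        by_cases hω : ε / 2 ≤ ‖Z n ω‖
        · rw [Set.indicator_of_mem (show ω ∈ {ω | ε / 2 ≤ ‖Z n ω‖} from hω)]
          have := hB n ω
          rw [Real.norm_eq_abs]
          linarith
        · rw [Set.indicator_of_notMem (show ω ∉ {ω | ε / 2 ≤ ‖Z n ω‖} from hω)]
          linarith
    _ = _ := by
        rw [integral_add (integrable_const _) ((integrable_const _).indicator hA),
          integral_indicator_const _ hA]
        simp [mul_comm]

end AngleVariance

/-! ### Convergence in probability and of expectations -/

namespace AngleVariance

open Classical in
lemma tendstoInMeasure_mul_statU_sub_statV {m d : ℕ}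
    {M : Set (EuclideanSpace ℝ (Fin m))} {p : EuclideanSpace ℝ (Fin m)}
    (hM : IsC2SubmanifoldAt d M p)
    {P : Measure (EuclideanSpace ℝ (Fin m))} (hP : HasLipschitzDensityNear d M P p)
    {Ω : Type*} [MeasurableSpace Ω] {μ : Measure Ω} [IsProbabilityMeasure μ]
    {X : ℕ → Ω → EuclideanSpace ℝ (Fin m)}
    (hX_meas : ∀ i, Measurable (X i)) (hX_law : ∀ i, μ.map (X i) = P) (hX_indep : iIndepFun X μ)
    {C : ℝ} (hC : 0 < C) {N : ℕ → Ω → Finset ℕ}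
    (hN : ∀ n ω, IsNearestNeighbors p (fun i => X i ω) n (numNeighbors C n) (N n ω)) :
    TendstoInMeasure μ (fun n ω => (numNeighbors C n : ℝ) *
      (statU p (numNeighbors C n) (N n ω) (fun i => X i ω) -
        statV M p (numNeighbors C n) (N n ω) (fun i => X i ω))) atTop (fun _ => 0) := by
  have hPprob : IsProbabilityMeasure P := by
    rw [← hX_law 0]
    exact Measure.isProbabilityMeasure_map (hX_meas 0).aemeasurable
  obtain ⟨K, r₁, hK, hr₁, hclose⟩ := hP.ae_norm_sub_starProjection_le hM
  obtain ⟨c, r₂, hc, hr₂, hmass⟩ := hP.exists_le_measure_closedBall hM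
  have hclose' : ∀ᵐ ω ∂μ, ∀ i, dist (X i ω) p < r₁ →
      ‖X i ω - p - (tangentSpaceAt M p).starProjection (X i ω - p)‖ ≤ K * ‖X i ω - p‖ ^ 2 :=
    ae_all_iff.2 fun i => ae_of_ae_map (hX_meas i).aemeasurable (by rwa [hX_law i])
  rw [tendstoInMeasure_iff_norm]
  intro ε hε
  obtain ⟨η, hη, hηε⟩ : ∃ η : ℝ, 0 < η ∧ 4 * (Real.pi ^ 2 * (K * η)) < ε := by
    refine ⟨ε / (8 * Real.pi ^ 2 * (K + 1)), by positivity, ?_⟩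
    have hpi := Real.pi_pos
    calc 4 * (Real.pi ^ 2 * (K * (ε / (8 * Real.pi ^ 2 * (K + 1)))))
        = K / (K + 1) * (ε / 2) := by field_simp; ring
      _ ≤ 1 * (ε / 2) := by
        gcongr
        rw [div_le_one (by positivity)]
        linarith
      _ < ε := by linarith
  set k : ℕ → ℕ := numNeighbors C
  have hk : Tendsto (fun n => (k n : ℝ)) atTop atTop := tendsto_numNeighbors hC
  -- `b n * k n` is `n` times the lower bound on the mass of the ball of radius `η / k n`. The
  -- exponent `d + 1` splits off the factor `k n`, so `b n ≥ 2` meets the condition `2k ≤ a` of the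
  -- counting lemma.
  set b : ℕ → ℝ := fun n => c * η ^ d * ((n : ℝ) / (k n : ℝ) ^ (d + 1))
  have hb : Tendsto b atTop atTop :=
    (tendsto_div_numNeighbors_pow hC (d + 1)).const_mul_atTop (by positivity)
  have hr : Tendsto (fun n => η / (k n : ℝ)) atTop (𝓝 0) := hk.const_div_atTop η
  have hlim : Tendsto (fun n => ENNReal.ofReal (4 / b n)) atTop (𝓝 0) := by
    simpa using ENNReal.tendsto_ofReal (hb.const_div_atTop 4)
  refine tendsto_of_tendsto_of_tendsto_of_le_of_le' tendsto_const_nhds hlim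
    (Eventually.of_forall fun _ => zero_le) ?_
  filter_upwards [hk.eventually_ge_atTop 1, hb.eventually_ge_atTop 2,
    hr.eventually_lt_const hr₁, hr.eventually_lt_const hr₂] with n hkn hbn hrn₁ hrn₂
  have hk0 : (0 : ℝ) < k n := by linarith
  set r := η / (k n : ℝ)
  have hr0 : 0 < r := by positivity
  have hq : c * r ^ d ≤ P.real (Metric.closedBall p r) :=
    (ENNReal.ofReal_le_iff_le_toReal (measure_ne_top _ _)).1 (hmass r hr0 hrn₂.le)
  have hbq : b n * k n ≤ n * P.real (Metric.closedBall p r) := by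
    calc b n * k n = n * (c * r ^ d) := by
          simp only [b, r, div_pow]
          field_simp
          ring
      _ ≤ _ := by gcongr
  have hbk : b n ≤ b n * k n := le_mul_of_one_le_right (by linarith) hkn
  have hcount := measure_card_filter_lt_le hX_meas hX_law hX_indep
    (Metric.isClosed_closedBall (x := p) (ε := r)).measurableSet (n := n) (k := k n)
    (a := b n * k n) (by positivity) (by gcongr) hbq
  refine le_trans ?_ (hcount.trans (ENNReal.ofReal_le_ofReal (by gcongr)))
  refine measure_mono_ae ?_
  filter_upwards [hclose'] with ω hω hε'
  -- Outside the event of fewer than `k` points in the ball, all neighbours lie within `r`, and then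
  -- the scaled difference is below `ε`.
  by_contra hge
  have hge' : k n ≤ ((Finset.range n).filter fun i => X i ω ∈ Metric.closedBall p r).card :=
    not_lt.1 hge
  have hdist : ∀ i ∈ N n ω, dist (X i ω) p ≤ r := fun i hi => (hN n ω).dist_le hge' hi
  have hle := abs_angleStatistic_sub_le (hN n ω).card_le (tangentSpaceAt M p)
    (fun i => X i ω - p) (δ := K * r) (by positivity) fun i hi => by
      refine (hω i ((hdist i hi).trans_lt hrn₁)).trans ?_
      have : ‖X i ω - p‖ ≤ r := by rw [← dist_eq_norm]; exact hdist i hi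
      rw [sq, ← mul_assoc]
      gcongr
  have hε'' : ε ≤ k n * |statU p (k n) (N n ω) (fun i => X i ω) -
      statV M p (k n) (N n ω) (fun i => X i ω)| := by
    have : ε ≤ ‖_ - _‖ := hε'
    rwa [sub_zero, norm_mul, Real.norm_natCast, Real.norm_eq_abs] at this
  have : (k n : ℝ) * |statU p (k n) (N n ω) (fun i => X i ω) -
      statV M p (k n) (N n ω) (fun i => X i ω)| ≤ k n * (4 * (Real.pi ^ 2 * (K * r))) :=
    mul_le_mul_of_nonneg_left hle hk0.le
  have heq : k n * (4 * (Real.pi ^ 2 * (K * r))) = 4 * (Real.pi ^ 2 * (K * η)) := by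
    simp only [r]
    field_simp
  linarith

end AngleVariance

theorem mainTheorem6 {m d : ℕ} (hd : 1 ≤ d) (hdm : d < m)
    (M : Set (EuclideanSpace ℝ (Fin m))) (p : EuclideanSpace ℝ (Fin m))
    (hM : AngleVariance.IsC2SubmanifoldAt d M p)
    (P : Measure (EuclideanSpace ℝ (Fin m)))
    (hP : AngleVariance.HasLipschitzDensityNear d M P p)
    {Ω : Type*} [MeasurableSpace Ω] (μ : Measure Ω) [IsProbabilityMeasure μ]
    (X : ℕ → Ω → EuclideanSpace ℝ (Fin m))
    (hX_meas : ∀ i, Measurable (X i)) (hX_law : ∀ i, μ.map (X i) = P) (hX_indep : iIndepFun X μ)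
    (C : ℝ) (hC : 0 < C)
    (N : ℕ → Ω → Finset ℕ)
    (hN_meas : ∀ n (S : Finset ℕ), MeasurableSet {ω | N n ω = S})
    (hN : ∀ n ω, AngleVariance.IsNearestNeighbors p (fun i => X i ω) n
      (AngleVariance.numNeighbors C n) (N n ω)) :
    let k : ℕ → ℕ := AngleVariance.numNeighbors C
    let U : ℕ → Ω → ℝ := fun n ω => AngleVariance.statU p (k n) (N n ω) (fun i => X i ω)
    let V : ℕ → Ω → ℝ := fun n ω => AngleVariance.statV M p (k n) (N n ω) (fun i => X i ω)
    TendstoInMeasure μ (fun n ω => (k n : ℝ) * (U n ω - V n ω)) atTop (fun _ => 0) ∧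
      (∀ n, Integrable (fun ω => U n ω - V n ω) μ) ∧
      Tendsto (fun n => ∫ ω, (U n ω - V n ω) ∂μ) atTop (𝓝 0) := by
  intro k U V
  have hconv := AngleVariance.tendstoInMeasure_mul_statU_sub_statV hM hP hX_meas hX_law hX_indep
    hC hN
  have hmeas : ∀ n, Measurable fun ω => U n ω - V n ω := fun n =>
    (AngleVariance.measurable_of_random_subset (hN_meas n) (fun ω => (hN n ω).1)
      fun S => AngleVariance.measurable_angleStatistic (k n) S
        fun i => (hX_meas i).sub_const p).sub
    (AngleVariance.measurable_of_random_subset (hN_meas n) (fun ω => (hN n ω).1)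
      fun S => AngleVariance.measurable_angleStatistic (k n) S fun i =>
        (AngleVariance.tangentSpaceAt M p).starProjection.continuous.measurable.comp
          ((hX_meas i).sub_const p))
  have hbound : ∀ n ω, |U n ω - V n ω| ≤ 4 * (Real.pi / 2) ^ 2 + 4 * (Real.pi / 2) ^ 2 :=
    fun n ω => (abs_sub _ _).trans (add_le_add
      (AngleVariance.abs_angleStatistic_le (hN n ω).card_le _)
      (AngleVariance.abs_angleStatistic_le (hN n ω).card_le _))
  refine ⟨hconv, fun n => Integrable.of_bound (hmeas n).aestronglyMeasurable _
    (ae_of_all _ (hbound n)),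
    AngleVariance.tendsto_integral_of_tendstoInMeasure_of_bounded hmeas hbound ?_⟩
  rw [tendstoInMeasure_iff_norm] at hconv ⊢
  intro ε hε
  refine tendsto_of_tendsto_of_tendsto_of_le_of_le' tendsto_const_nhds (hconv ε hε)
    (Eventually.of_forall fun _ => zero_le) ?_
  -- Once `k ≥ 1`, the factor `k` only enlarges the difference, so its exceedance event contains the
  -- unscaled one.
  filter_upwards [(AngleVariance.tendsto_numNeighbors hC).eventually_ge_atTop 1] with n hn
  refine measure_mono fun ω (hω : ε ≤ ‖_ - _‖) => ?_
  change ε ≤ ‖_ - _‖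
  rw [sub_zero] at hω ⊢
  rw [norm_mul, Real.norm_natCast]
  exact hω.trans (le_mul_of_one_le_left (norm_nonneg _) hn)
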